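/- Let $n\ge 0$ and let $f:\{0,1\}^n\to\{0,1\}$ be a Boolean function that is not constant. For an input $x$, let $s(f,x)$ be the number of indices $i$ such that flipping the $i$-th bit of $x$ changes the value of $f$, and let $C(f,x)$ be the minimum of $|P|$ over all partial assignments $c:P\to\{0,1\}$, $P\subseteq\{1,\dots,n\}$, that $x$ satisfies (that is, $x_i=c(i)$ for all $i\in P$) and such that $f$ is constant on the set of all inputs satisfying $c$. For $b\in\{0,1\}$ put $$s_b(f)=\max\{s(f,x): f(x)=b\},\qquad C_b(f)=\max\{C(f,x): f(x)=b\}.$$ Then: 1. if $s_1(f)=1$, then $C_0(f)=s_0(f)$; if $s_1(f)>1$, then $$C_0(f)\le 2^{s_1(f)-1}\left(s_0(f)-\tfrac13\right);$$ 2. symmetrically, if $s_0(f)=1$, then $C_1(f)=s_1(f)$; if $s_0(f)>1$, then $$C_1(f)\le 2^{s_0(f)-1}\left(s_1(f)-\tfrac13\right).$$ -/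

import Mathlib

namespace BooleanComplexity

/-- The input `x^P`, obtained from `x` by flipping every bit whose index lies in `P`. -/
def flip {n : ℕ} (x : Fin n → Bool) (P : Finset (Fin n)) : Fin n → Bool :=
  fun i => if i ∈ P then !(x i) else x i

/-- The sensitivity `s(f, x)` of `f` on the input `x`. -/
def sensitivityAt {n : ℕ} (f : (Fin n → Bool) → Bool) (x : Fin n → Bool) : ℕ :=
  (Finset.univ.filter fun i : Fin n => f x ≠ f (flip x {i})).card

/-- The `b`-sensitivity `s_b(f)`: the maximum of `s(f, x)` over the inputs `x` with `f x = b`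
(it is `0` if there is no such input). -/
def bSensitivity {n : ℕ} (f : (Fin n → Bool) → Bool) (b : Bool) : ℕ :=
  (Finset.univ.filter fun x : Fin n → Bool => f x = b).sup (sensitivityAt f)

/-- The input `x` satisfies the partial assignment `c : P → {0,1}`. -/
def Satisfies {n : ℕ} (x : Fin n → Bool) (P : Finset (Fin n)) (c : P → Bool) : Prop :=
  ∀ i : P, x i = c i

/-- The partial assignment `c : P → {0,1}` is a certificate of `f`: `f` is constant on the
subcube of the inputs that satisfy `c`. -/
def IsCertificate {n : ℕ} (f : (Fin n → Bool) → Bool) (P : Finset (Fin n)) (c : P → Bool) :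
    Prop :=
  ∃ b : Bool, ∀ y : Fin n → Bool, Satisfies y P c → f y = b

/-- The certificate complexity `C(f, x)`: the minimum length `|P|` of a certificate
`c : P → {0,1}` of `f` that `x` satisfies. (The set is non-empty, since `P` may be everything.) -/
noncomputable def certificateAt {n : ℕ} (f : (Fin n → Bool) → Bool) (x : Fin n → Bool) : ℕ :=
  sInf {l : ℕ | ∃ (P : Finset (Fin n)) (c : P → Bool),
    Satisfies x P c ∧ IsCertificate f P c ∧ P.card = l}

/-- The `b`-certificate complexity `C_b(f)`: the maximum of `C(f, x)` over the inputs `x` with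
`f x = b` (it is `0` if there is no such input). -/
noncomputable def bCertificate {n : ℕ} (f : (Fin n → Bool) → Bool) (b : Bool) : ℕ :=
  (Finset.univ.filter fun x : Fin n → Bool => f x = b).sup (certificateAt f)

end BooleanComplexity

namespace BooleanComplexity

variable {n : ℕ}

/-! ### Single bit flips. -/

section Flip

/-! Write `s = s_{!b}`, `r = s - 1`. An irreducible certificate gives a subcube of dimension `d`
(free positions `D`) on which `f = b` and, for each fixed position `i`, a nonempty crossing: the
points `y` with `f (y^i) ≠ b`. As `y^i` is sensitive at `i`, at most `r` flips in `D` leave the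
crossing. By `eq_cube_or_three_mul_le` it is therefore light (a subcube of size `2^(d-r)`) or heavy
(at least 3/2 times that size). Each point lies on at most `s_b` crossings, so counting incidences
bounds the number of fixed positions.

The saving of 1/3 comes from rigidity. If a point lies on `s_b` light crossings, flipping a bit
fixed by one of them loses that crossing and gains none. Double counting these flips
(`IsLightFamily.card_fullPoints_le`) shows that full points are no more numerous than deficient
ones. So either the light crossings miss many points or many incidences are wasted;
`three_mul_card_compl_le` balances the two. -/

theorem flip_apply_same (x : Fin n → Bool) (i : Fin n) : flip x {i} i = !(x i) := by
  simp [flip]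

theorem flip_apply_of_ne (x : Fin n → Bool) {i j : Fin n} (h : j ≠ i) : flip x {i} j = x j := by
  simp [flip, h]

theorem flip_flip_same (x : Fin n → Bool) (i : Fin n) : flip (flip x {i}) {i} = x := by
  funext j
  by_cases h : j = i <;> simp [flip, h]

theorem flip_flip_comm (x : Fin n → Bool) (i j : Fin n) :
    flip (flip x {i}) {j} = flip (flip x {j}) {i} := by
  funext k
  simp only [flip, Finset.mem_singleton]
  split_ifs <;> rfl

theorem flip_singleton_injective (x : Fin n → Bool) :
    Function.Injective fun i : Fin n => flip x {i} := by
  intro i j h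
  by_contra hne
  have h' := congrFun h i
  simp only [flip_apply_same, flip_apply_of_ne x hne] at h'
  simp at h'

theorem flip_left_injective (i : Fin n) :
    Function.Injective fun x : Fin n → Bool => flip x {i} := by
  intro x y h
  have h' : flip (flip x {i}) {i} = flip (flip y {i}) {i} := congrArg (fun z => flip z {i}) h
  rwa [flip_flip_same, flip_flip_same] at h'

end Flip

/-! ### Subcubes, and sets with few outward flips. -/

section Cube

/-- The subcube of the inputs that agree with `a` outside `D`. -/
def cube (a : Fin n → Bool) (D : Finset (Fin n)) : Finset (Fin n → Bool) :=
  Fintype.piFinset fun i => if i ∈ D then Finset.univ else {a i}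

theorem mem_cube {a x : Fin n → Bool} {D : Finset (Fin n)} :
    x ∈ cube a D ↔ ∀ i, i ∉ D → x i = a i := by
  simp only [cube, Fintype.mem_piFinset]
  refine forall_congr' fun i => ?_
  by_cases h : i ∈ D <;> simp [h]

theorem card_cube (a : Fin n → Bool) (D : Finset (Fin n)) : (cube a D).card = 2 ^ D.card := by
  simp only [cube, Fintype.card_piFinset, apply_ite Finset.card, Finset.card_singleton,
    Finset.card_univ, Fintype.card_bool]
  simp

theorem flip_mem_cube {a x : Fin n → Bool} {D : Finset (Fin n)} {i : Fin n}
    (hx : x ∈ cube a D) (hi : i ∈ D) : flip x {i} ∈ cube a D := by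
  rw [mem_cube] at hx ⊢
  intro j hj
  rw [flip_apply_of_ne x (by rintro rfl; exact hj hi)]
  exact hx j hj

theorem flip_notMem_cube {a x : Fin n → Bool} {D : Finset (Fin n)} {i : Fin n}
    (hx : x ∈ cube a D) (hi : i ∉ D) : flip x {i} ∉ cube a D := by
  rw [mem_cube] at hx ⊢
  intro h
  have h' := h i hi
  rw [flip_apply_same, hx i hi] at h'
  simp at h'

/-- If at most `r` flips take `x` out of `V`, and the `r` flips in `F` do, then no other does. -/
theorem flip_mem_of_card_le {V : Finset (Fin n → Bool)} {D F : Finset (Fin n)} {r : ℕ}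
    {x : Fin n → Bool} {i : Fin n} (hV : (D.filter fun j => flip x {j} ∉ V).card ≤ r)
    (hFD : F ⊆ D) (hF : F.card = r) (hout : ∀ j ∈ F, flip x {j} ∉ V) (hi : i ∈ D) (hiF : i ∉ F) :
    flip x {i} ∈ V := by
  by_contra h
  have hsub : insert i F ⊆ D.filter fun j => flip x {j} ∉ V := by
    intro j hj
    rcases Finset.mem_insert.1 hj with rfl | hj
    · exact Finset.mem_filter.2 ⟨hi, h⟩
    · exact Finset.mem_filter.2 ⟨hFD hj, hout j hj⟩
  have := Finset.card_le_card hsub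
  rw [Finset.card_insert_of_notMem hiF] at this
  omega

/-- A set `V` of points of a `d`-dimensional cube each of which has at most `r` neighbours outside
`V` is a subcube of codimension `r`, or has at least `3/2 * 2 ^ (d - r)` points. -/
theorem eq_cube_or_three_mul_le (D : Finset (Fin n)) :
    ∀ (r : ℕ) (a : Fin n → Bool) (V : Finset (Fin n → Bool)), V.Nonempty → V ⊆ cube a D →
      (∀ x ∈ V, (D.filter fun j => flip x {j} ∉ V).card ≤ r) →
      (∃ F ⊆ D, F.card = r ∧ ∃ a', V = cube a' (D \ F)) ∨
        3 * 2 ^ D.card ≤ 2 ^ (r + 1) * V.card := by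
  induction D using Finset.strongInduction with
  | H D ih =>
  intro r a V hne hsub hV
  -- the size bound that both alternatives imply
  have simon : ∀ i ∈ D, ∀ (a' : Fin n → Bool) (W : Finset (Fin n → Bool)), W.Nonempty →
      W ⊆ cube a' (D.erase i) →
      (∀ x ∈ W, ((D.erase i).filter fun j => flip x {j} ∉ W).card ≤ r) →
      2 ^ D.card ≤ 2 ^ (r + 1) * W.card := by
    intro i hi a' W h1 h2 h3
    have hc : D.card = (D.erase i).card + 1 := (Finset.card_erase_add_one hi).symm
    rcases ih _ (Finset.erase_ssubset hi) r a' W h1 h2 h3 with ⟨F, hFD, hF, a'', rfl⟩ | h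
    · rw [card_cube, ← pow_add, hc, Finset.card_sdiff_of_subset hFD, hF]
      exact Nat.pow_le_pow_right (by norm_num) (by omega)
    · rw [hc, pow_succ]
      have : 0 < 2 ^ (D.erase i).card := by positivity
      omega
  have half : ∀ i ∈ D, ∀ b : Bool, (V.filter fun x => x i = b) ⊆
        cube (Function.update a i b) (D.erase i) ∧
      ∀ x ∈ V.filter fun x => x i = b,
        ((D.erase i).filter fun j => flip x {j} ∉ V.filter fun x => x i = b).card ≤ r := by
    intro i hi b
    constructor
    · intro x hx
      obtain ⟨hxV, hxb⟩ := Finset.mem_filter.1 hx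
      rw [mem_cube]
      intro j hj
      by_cases hji : j = i
      · subst hji; simp [hxb]
      · rw [Function.update_of_ne hji]
        exact mem_cube.1 (hsub hxV) j fun h => hj (Finset.mem_erase.2 ⟨hji, h⟩)
    · intro x hx
      obtain ⟨hxV, hxb⟩ := Finset.mem_filter.1 hx
      refine (Finset.card_le_card ?_).trans (hV x hxV)
      intro j hj
      obtain ⟨hj1, hj2⟩ := Finset.mem_filter.1 hj
      obtain ⟨hji, hjD⟩ := Finset.mem_erase.1 hj1
      refine Finset.mem_filter.2 ⟨hjD, fun h => hj2 (Finset.mem_filter.2 ⟨h, ?_⟩)⟩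
      rw [flip_apply_of_ne x (Ne.symm hji), hxb]
  -- If `V` misses a half, flipping `i` always leaves `V`, so both the dimension and `r` drop by
  -- one.
  by_cases hside : ∃ i ∈ D, ∃ b : Bool, (V.filter fun x => x i = b) = ∅
  · obtain ⟨i, hi, b, hb⟩ := hside
    have hall : ∀ x ∈ V, x i = !b := by
      intro x hx
      have : x ∉ V.filter fun x => x i = b := by simp [hb]
      rw [Finset.mem_filter, not_and] at this
      have := this hx
      cases h : x i <;> cases b <;> simp_all
    have hVeq : (V.filter fun x => x i = !b) = V := Finset.filter_true_of_mem hall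
    have hout : ∀ x ∈ V, flip x {i} ∉ V := by
      intro x hx h
      have h1 := hall _ h
      rw [flip_apply_same, hall x hx] at h1
      simp at h1
    have hlt : ∀ x ∈ V, ((D.erase i).filter fun j => flip x {j} ∉ V).card + 1 ≤ r := by
      intro x hx
      refine le_trans ?_ (hV x hx)
      have : D.filter (fun j => flip x {j} ∉ V) =
          insert i ((D.erase i).filter fun j => flip x {j} ∉ V) := by
        rw [← Finset.insert_erase hi, Finset.filter_insert, if_pos (hout x hx),
          Finset.erase_insert (Finset.notMem_erase i D)]
      rw [this, Finset.card_insert_of_notMem (by simp)]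
    obtain ⟨r, rfl⟩ : ∃ r', r = r' + 1 := by
      obtain ⟨x, hx⟩ := hne
      have := hlt x hx
      exact ⟨r - 1, by omega⟩
    have hsub' := (half i hi (!b)).1
    rw [hVeq] at hsub'
    rcases ih _ (Finset.erase_ssubset hi) r _ V hne hsub'
      (fun x hx => by have := hlt x hx; omega) with ⟨F, hFD, hF, a', ha'⟩ | h
    · left
      have hiF : i ∉ F := fun h => Finset.notMem_erase i D (hFD h)
      refine ⟨insert i F, ?_, ?_, a', ?_⟩
      · exact Finset.insert_subset hi (hFD.trans (Finset.erase_subset i D))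
      · rw [Finset.card_insert_of_notMem hiF, hF]
      · rw [ha']; congr 1; ext j; simp; tauto
    · right
      rw [← Finset.card_erase_add_one hi, pow_succ, pow_succ 2 (r + 1)]
      linarith
  push Not at hside
  rcases D.eq_empty_or_nonempty with rfl | ⟨i, hi⟩
  · have hVa : V = cube a ∅ := by
      refine Finset.eq_of_subset_of_card_le hsub ?_
      rw [card_cube]; simpa using hne
    rcases Nat.eq_zero_or_pos r with rfl | hr
    · exact Or.inl ⟨∅, by simp, by simp, a, by simpa using hVa⟩
    · right
      rw [hVa, card_cube]
      have : 2 ^ 2 ≤ 2 ^ (r + 1) := Nat.pow_le_pow_right (by norm_num) (by omega)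
      simp; omega
  have hc : D.card = (D.erase i).card + 1 := (Finset.card_erase_add_one hi).symm
  by_cases hheavy : ∀ b : Bool,
      3 * 2 ^ (D.erase i).card ≤ 2 ^ (r + 1) * (V.filter fun x => x i = b).card
  · right
    have h1 := hheavy true
    have h2 := hheavy false
    have h3 : V.card = (V.filter fun x => x i = true).card +
        (V.filter fun x => x i = false).card := by
      rw [← Finset.card_filter_add_card_filter_not (s := V) fun x => x i = true]
      simp
    rw [h3, hc, pow_succ]
    linarith
  push Not at hheavy
  obtain ⟨b, hb⟩ := hheavy
  set U := V.filter fun x => x i = b with hU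
  have hUne : U.Nonempty := hside i hi b
  rcases ih _ (Finset.erase_ssubset hi) r _ U hUne (half i hi b).1 (half i hi b).2 with
    ⟨F, hFD, hF, a', ha'⟩ | h
  swap
  · omega
  have hiF : i ∉ F := fun h => Finset.notMem_erase i D (hFD h)
  have hFD' : F ⊆ D := hFD.trans (Finset.erase_subset i D)
  have hUV : U ⊆ V := Finset.filter_subset _ _
  -- The `r` directions in `F` already exhaust the outward flips at points of `U`.
  have hflip : ∀ x ∈ U, flip x {i} ∈ V := by
    intro x hx
    refine flip_mem_of_card_le (hV x (hUV hx)) hFD' hF ?_ hi hiF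
    intro j hj hmem
    have hji : j ≠ i := by rintro rfl; exact hiF hj
    have : flip x {j} ∈ U := Finset.mem_filter.2
      ⟨hmem, by rw [flip_apply_of_ne x (Ne.symm hji)]; exact (Finset.mem_filter.1 hx).2⟩
    rw [ha'] at this hx
    exact flip_notMem_cube hx (by simp [hj]) this
  rcases F.eq_empty_or_nonempty with rfl | ⟨e, he⟩
  · left
    refine ⟨∅, by simp, hF, a, ?_⟩
    refine Finset.Subset.antisymm (by simpa using hsub) ?_
    have hUeq : U = cube (Function.update a i b) (D.erase i) := by
      refine Finset.eq_of_subset_of_card_le (half i hi b).1 ?_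
      rw [ha', card_cube, card_cube]; simp
    intro x hx
    rw [Finset.sdiff_empty, mem_cube] at hx
    by_cases hxi : x i = b
    · apply hUV
      rw [hUeq, mem_cube]
      intro j hj
      by_cases hji : j = i
      · subst hji; simp [hxi]
      · rw [Function.update_of_ne hji]
        exact hx j fun h => hj (Finset.mem_erase.2 ⟨hji, h⟩)
    · rw [← flip_flip_same x i]
      apply hflip
      rw [hUeq, mem_cube]
      intro j hj
      by_cases hji : j = i
      · subst hji
        rw [flip_apply_same, Function.update_self]
        revert hxi
        cases x j <;> cases b <;> simp
      · rw [Function.update_of_ne hji, flip_apply_of_ne x hji]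
        exact hx j fun h => hj (Finset.mem_erase.2 ⟨hji, h⟩)
  · right
    -- Three disjoint pieces of `V`, each of size at least `2^(d-1-r)`: the light half `U`, its
    -- reflection in `i`, and the part of `V` across the fixed position `e`, nonempty since `V`
    -- meets every half.
    have heD := hFD' he
    have hei : e ≠ i := by rintro rfl; exact hiF he
    have hUe : ∀ x ∈ U, x e = a' e := by
      intro x hx
      rw [ha', mem_cube] at hx
      exact hx e (by simp [he])
    set W := V.filter fun x => x e = !(a' e) with hW
    have hWcard := simon e heD _ W (hside e heD _) (half e heD _).1 (half e heD _).2
    have hUcard := simon i hi _ U hUne (half i hi b).1 (half i hi b).2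
    set U' := U.image fun x => flip x {i} with hU'
    have hU'card : U'.card = U.card := Finset.card_image_of_injective _ (flip_left_injective i)
    have hd1 : Disjoint U U' := by
      rw [Finset.disjoint_left]
      rintro x hx hx'
      obtain ⟨y, hy, rfl⟩ := Finset.mem_image.1 hx'
      have h1 := (Finset.mem_filter.1 hx).2
      have h2 := (Finset.mem_filter.1 hy).2
      rw [flip_apply_same, h2] at h1
      simp at h1
    have hd2 : Disjoint (U ∪ U') W := by
      rw [Finset.disjoint_left]
      rintro x hx hx'
      have h1 := (Finset.mem_filter.1 hx').2
      have h2 : x e = a' e := by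
        rcases Finset.mem_union.1 hx with hx | hx
        · exact hUe x hx
        · obtain ⟨y, hy, rfl⟩ := Finset.mem_image.1 hx
          rw [flip_apply_of_ne y hei]
          exact hUe y hy
      rw [h2] at h1
      simp at h1
    have hsubV : U ∪ U' ∪ W ⊆ V := by
      refine Finset.union_subset (Finset.union_subset hUV ?_) (Finset.filter_subset _ _)
      intro x hx
      obtain ⟨y, hy, rfl⟩ := Finset.mem_image.1 hx
      exact hflip y hy
    have hle := Finset.card_le_card hsubV
    rw [Finset.card_union_of_disjoint hd2, Finset.card_union_of_disjoint hd1, hU'card] at hle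
    calc 3 * 2 ^ D.card ≤ 2 ^ (r + 1) * (U.card + U.card + W.card) := by linarith
      _ ≤ _ := Nat.mul_le_mul_left _ hle

end Cube

end BooleanComplexity

namespace BooleanComplexity

variable {n : ℕ}

/-! ### Sensitivity and irreducible certificates. -/

section Sensitivity

theorem card_le_bSensitivity {f : (Fin n → Bool) → Bool} {x : Fin n → Bool}
    {T : Finset (Fin n)} (hT : ∀ i ∈ T, f x ≠ f (flip x {i})) :
    T.card ≤ bSensitivity f (f x) := by
  have h1 : T.card ≤ sensitivityAt f x :=
    Finset.card_le_card fun i hi => Finset.mem_filter.2 ⟨Finset.mem_univ i, hT i hi⟩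
  exact h1.trans (Finset.le_sup (f := sensitivityAt f)
    (Finset.mem_filter.2 ⟨Finset.mem_univ x, rfl⟩))

theorem card_le_bSensitivity_of_eq {f : (Fin n → Bool) → Bool} {b : Bool} {x : Fin n → Bool}
    {T : Finset (Fin n)} (hx : f x = b) (hT : ∀ i ∈ T, f (flip x {i}) ≠ b) :
    T.card ≤ bSensitivity f b := by
  subst hx
  exact card_le_bSensitivity fun i hi => (hT i hi).symm

theorem card_le_bSensitivity_of_ne {f : (Fin n → Bool) → Bool} {b : Bool} {x : Fin n → Bool}
    {T : Finset (Fin n)} (hx : f x ≠ b) (hT : ∀ i ∈ T, f (flip x {i}) = b) :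
    T.card ≤ bSensitivity f (!b) := by
  have hb : f x = !b := by revert hx; cases f x <;> cases b <;> simp
  rw [← hb]
  exact card_le_bSensitivity fun i hi => by rw [hT i hi]; exact hx

/-- The certificate complexity of an input is at least its sensitivity. -/
theorem sensitivityAt_le_certificateAt (f : (Fin n → Bool) → Bool) (x : Fin n → Bool) :
    sensitivityAt f x ≤ certificateAt f x := by
  refine le_csInf ⟨_, Finset.univ, fun i => x i, fun i => rfl, ⟨f x, fun y hy => ?_⟩, rfl⟩ ?_
  · congr 1
    funext i
    exact hy ⟨i, Finset.mem_univ i⟩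
  · rintro l ⟨P, c, hx, ⟨b, hb⟩, rfl⟩
    refine Finset.card_le_card fun i hi => ?_
    by_contra hiP
    refine (Finset.mem_filter.1 hi).2 ?_
    rw [hb x hx, hb (flip x {i})]
    intro j
    rw [flip_apply_of_ne x (by intro h; exact hiP (h ▸ j.2))]
    exact hx j

/-- An input with value `b` has a certificate of length at least `C(f, x)` no position of which
can be dropped; `D` is the set of the positions that it leaves free. -/
theorem exists_irreducible_certificate (f : (Fin n → Bool) → Bool) (x : Fin n → Bool) :
    ∃ D : Finset (Fin n), certificateAt f x ≤ Dᶜ.card ∧ (∀ y ∈ cube x D, f y = f x) ∧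
      ∀ i ∉ D, ∃ y ∈ cube x (insert i D), f y ≠ f x := by
  classical
  -- Irreducibility is maximality of the free set.
  obtain ⟨D, -, hD⟩ := (Set.toFinite {D : Finset (Fin n) | ∀ y ∈ cube x D, f y = f x}
    ).exists_le_maximal (a := ∅) (by
      intro y hy
      rw [show y = x from funext fun i => mem_cube.1 hy i (by simp)])
  refine ⟨D, ?_, hD.1, ?_⟩
  · refine Nat.sInf_le ⟨Dᶜ, fun i => x i, fun i => rfl, ⟨f x, fun y hy => hD.1 y ?_⟩, rfl⟩
    exact mem_cube.2 fun i hi => hy ⟨i, Finset.mem_compl.2 hi⟩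
  · intro i hi
    by_contra! h
    exact hi (hD.2 (y := insert i D) h (Finset.subset_insert i D) (Finset.mem_insert_self i D))

end Sensitivity

/-! ### Crossings, full points and deficient points. -/

section Crossing

/-- The points of the subcube of the inputs agreeing with `x` outside `D` that reach a value other
than `b` when the bit `i` is flipped. -/
def crossing (f : (Fin n → Bool) → Bool) (b : Bool) (x : Fin n → Bool) (D : Finset (Fin n))
    (i : Fin n) : Finset (Fin n → Bool) :=
  (cube x D).filter fun y => f (flip y {i}) ≠ b

variable {f : (Fin n → Bool) → Bool} {b : Bool} {x : Fin n → Bool} {D : Finset (Fin n)}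

theorem mem_crossing {i : Fin n} {y : Fin n → Bool} :
    y ∈ crossing f b x D i ↔ y ∈ cube x D ∧ f (flip y {i}) ≠ b := Finset.mem_filter

theorem crossing_subset (i : Fin n) : crossing f b x D i ⊆ cube x D := Finset.filter_subset _ _

theorem crossing_nonempty (hD : ∀ y ∈ cube x D, f y = b) {i : Fin n}
    (h : ∃ y ∈ cube x (insert i D), f y ≠ b) : (crossing f b x D i).Nonempty := by
  obtain ⟨y, hy, hyb⟩ := h
  rw [mem_cube] at hy
  have hyi : y i = !(x i) := by
    by_contra hne
    refine hyb (hD y (mem_cube.2 fun j hj => ?_))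
    by_cases hji : j = i
    · subst hji
      revert hne
      cases y j <;> cases x j <;> simp
    · exact hy j (by simp [hji, hj])
  refine ⟨flip y {i}, mem_crossing.2 ⟨mem_cube.2 fun j hj => ?_, by rwa [flip_flip_same]⟩⟩
  by_cases hji : j = i
  · subst hji
    rw [flip_apply_same, hyi, Bool.not_not]
  · rw [flip_apply_of_ne y hji]
    exact hy j (by simp [hji, hj])

/-- The points reached from a crossing are sensitive in the crossing direction as well. -/
theorem card_insert_le_of_mem_crossing (hD : ∀ y ∈ cube x D, f y = b) {i : Fin n}
    {y : Fin n → Bool} (hy : y ∈ crossing f b x D i) {T : Finset (Fin n)}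
    (hT : ∀ j ∈ T, f (flip (flip y {j}) {i}) = b) :
    (insert i T).card ≤ bSensitivity f (!b) := by
  refine card_le_bSensitivity_of_ne (mem_crossing.1 hy).2 fun j hj => ?_
  rcases Finset.mem_insert.1 hj with rfl | hj
  · rw [flip_flip_same]
    exact hD y (crossing_subset _ hy)
  · rw [flip_flip_comm]
    exact hT j hj

/-- Each flip leaving the crossing is a sensitive direction of `y^i`; the direction `i` itself makes
the inequality strict. -/
theorem card_filter_crossing_lt (hD : ∀ y ∈ cube x D, f y = b) {i : Fin n} (hi : i ∉ D)
    {y : Fin n → Bool} (hy : y ∈ crossing f b x D i) :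
    (D.filter fun j => flip y {j} ∉ crossing f b x D i).card < bSensitivity f (!b) := by
  have := card_insert_le_of_mem_crossing hD hy
    (T := D.filter fun j => flip y {j} ∉ crossing f b x D i) (by
      intro j hj
      obtain ⟨hjD, hj⟩ := Finset.mem_filter.1 hj
      by_contra h
      exact hj (mem_crossing.2 ⟨flip_mem_cube (crossing_subset _ hy) hjD, h⟩))
  rwa [Finset.card_insert_of_notMem (by simp [hi])] at this

theorem card_filter_mem_crossing_le (hD : ∀ y ∈ cube x D, f y = b) {y : Fin n → Bool}
    (hy : y ∈ cube x D) (S : Finset (Fin n)) :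
    (S.filter fun i => y ∈ crossing f b x D i).card ≤ bSensitivity f b :=
  card_le_bSensitivity_of_eq (hD y hy) fun _ hi => (mem_crossing.1 (Finset.mem_filter.1 hi).2).2

/-- The crossings in the directions `L` are subcubes of the least possible size, where `F i` are
the positions fixed by the crossing in direction `i`. -/
def IsLightFamily (f : (Fin n → Bool) → Bool) (b : Bool) (x : Fin n → Bool) (D L : Finset (Fin n))
    (F : Fin n → Finset (Fin n)) : Prop :=
  ∀ i ∈ L, i ∉ D ∧ F i ⊆ D ∧ (F i).card + 1 = bSensitivity f (!b) ∧
    ∃ a, crossing f b x D i = cube a (D \ F i)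

/-- The points that lie on as many crossings of the family `L` as the sensitivity permits. -/
def fullPoints (f : (Fin n → Bool) → Bool) (b : Bool) (x : Fin n → Bool) (D L : Finset (Fin n)) :
    Finset (Fin n → Bool) :=
  (cube x D).filter fun y => (L.filter fun i => y ∈ crossing f b x D i).card = bSensitivity f b

/-- The points that lie on fewer crossings than the sensitivity permits. -/
def deficientPoints (f : (Fin n → Bool) → Bool) (b : Bool) (x : Fin n → Bool)
    (D : Finset (Fin n)) : Finset (Fin n → Bool) :=
  (cube x D).filter fun y => (Dᶜ.filter fun i => y ∈ crossing f b x D i).card < bSensitivity f b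

variable {L : Finset (Fin n)} {F : Fin n → Finset (Fin n)}

theorem IsLightFamily.flip_mem_iff (hL : IsLightFamily f b x D L F) {i : Fin n} (hi : i ∈ L)
    {y : Fin n → Bool} (hy : y ∈ crossing f b x D i) {e : Fin n} (he : e ∈ D) :
    flip y {e} ∈ crossing f b x D i ↔ e ∉ F i := by
  obtain ⟨-, -, -, a, ha⟩ := hL i hi
  rw [ha] at hy ⊢
  refine ⟨fun h heF => flip_notMem_cube hy (by simp [heF]) h, fun h => flip_mem_cube hy ?_⟩
  simp [he, h]

/-- A point reached by a light crossing is not sensitive in any further direction. -/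
theorem IsLightFamily.flip_flip_ne (hD : ∀ y ∈ cube x D, f y = b)
    (hL : IsLightFamily f b x D L F) {i : Fin n} (hi : i ∈ L)
    {y : Fin n → Bool} (hy : y ∈ crossing f b x D i) {k : Fin n} (hk : k ∉ D) (hki : k ≠ i) :
    f (flip (flip y {k}) {i}) ≠ b := by
  obtain ⟨hiD, hFD, hF, -⟩ := hL i hi
  intro h
  have hkF : k ∉ F i := fun h => hk (hFD h)
  have := card_insert_le_of_mem_crossing hD hy (T := insert k (F i)) (by
    intro j hj
    rcases Finset.mem_insert.1 hj with rfl | hj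
    · exact h
    · by_contra hne
      exact (hL.flip_mem_iff hi hy (hFD hj)).1
        (mem_crossing.2 ⟨flip_mem_cube (crossing_subset _ hy) (hFD hj), hne⟩) hj)
  rw [Finset.card_insert_of_notMem, Finset.card_insert_of_notMem hkF] at this
  · omega
  · rw [Finset.mem_insert]
    rintro (h | h)
    · exact hki h.symm
    · exact hiD (hFD h)

/-- A crossing that misses a full point misses its neighbours, too. -/
theorem IsLightFamily.flip_notMem_crossing (hD : ∀ y ∈ cube x D, f y = b)
    (hL : IsLightFamily f b x D L F) {y : Fin n → Bool} (hy : y ∈ fullPoints f b x D L)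
    {k e : Fin n} (hk : k ∉ D) (he : e ∈ D) (hyk : y ∉ crossing f b x D k) :
    flip y {e} ∉ crossing f b x D k := by
  intro h
  obtain ⟨hyD, hcard⟩ := Finset.mem_filter.1 hy
  have hfk : f (flip y {k}) = b := by
    by_contra hne
    exact hyk (mem_crossing.2 ⟨hyD, hne⟩)
  -- At `y^k`, of value `b`, the `s_b` light crossings through `y` stay sensitive; `e` would be one
  -- direction too many.
  have := card_le_bSensitivity_of_eq hfk
    (T := insert e (L.filter fun i => y ∈ crossing f b x D i)) (by
      intro j hj
      rcases Finset.mem_insert.1 hj with rfl | hj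
      · rw [flip_flip_comm]
        exact (mem_crossing.1 h).2
      · obtain ⟨hjL, hyj⟩ := Finset.mem_filter.1 hj
        exact hL.flip_flip_ne hD hjL hyj hk (by rintro rfl; exact hyk hyj))
  rw [Finset.card_insert_of_notMem] at this
  · omega
  · intro h
    exact (hL e (Finset.mem_filter.1 h).1).1 he

/-- The flip loses crossing `i` and, by `flip_notMem_crossing`, gains none. -/
theorem IsLightFamily.flip_mem_deficientPoints (hD : ∀ y ∈ cube x D, f y = b)
    (hL : IsLightFamily f b x D L F) {y : Fin n → Bool} (hy : y ∈ fullPoints f b x D L)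
    {i e : Fin n} (hi : i ∈ L) (hyi : y ∈ crossing f b x D i) (he : e ∈ F i) :
    flip y {e} ∈ deficientPoints f b x D := by
  obtain ⟨hiD, hFD, -⟩ := hL i hi
  have hyD := (Finset.mem_filter.1 hy).1
  refine Finset.mem_filter.2 ⟨flip_mem_cube hyD (hFD he), ?_⟩
  refine (Finset.card_lt_card ?_).trans_le (card_filter_mem_crossing_le hD hyD Dᶜ)
  rw [Finset.ssubset_iff_of_subset]
  · refine ⟨i, Finset.mem_filter.2 ⟨Finset.mem_compl.2 hiD, hyi⟩, fun h => ?_⟩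
    exact (hL.flip_mem_iff hi hyi (hFD he)).1 (Finset.mem_filter.1 h).2 he
  · intro k hk
    obtain ⟨hkD, hk⟩ := Finset.mem_filter.1 hk
    refine Finset.mem_filter.2 ⟨hkD, ?_⟩
    by_contra h
    exact hL.flip_notMem_crossing hD hy (Finset.mem_compl.1 hkD) (hFD he) h hk

/-- A deficient point has few full neighbours: they all lie in the directions fixed by a single
light crossing. -/
theorem IsLightFamily.card_filter_flip_mem_fullPoints_le (hD : ∀ y ∈ cube x D, f y = b)
    (hL : IsLightFamily f b x D L F) {z : Fin n → Bool} (hz : z ∈ deficientPoints f b x D) :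
    (D.filter fun e => flip z {e} ∈ fullPoints f b x D L).card ≤ bSensitivity f (!b) - 1 := by
  rcases (D.filter fun e => flip z {e} ∈ fullPoints f b x D L).eq_empty_or_nonempty with h | ⟨e, he⟩
  · simp [h]
  obtain ⟨heD, hfull⟩ := Finset.mem_filter.1 he
  obtain ⟨k, hkL, hk, hzk⟩ : ∃ k ∈ L, flip z {e} ∈ crossing f b x D k ∧
      z ∉ crossing f b x D k := by
    by_contra! h
    refine (Finset.mem_filter.1 hz).2.not_ge ?_
    rw [← (Finset.mem_filter.1 hfull).2]
    refine Finset.card_le_card fun k hk => ?_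
    obtain ⟨hkL, hk⟩ := Finset.mem_filter.1 hk
    exact Finset.mem_filter.2 ⟨Finset.mem_compl.2 (hL k hkL).1, h k hkL hk⟩
  obtain ⟨hkD, hFD, hF, -⟩ := hL k hkL
  rw [← hF, Nat.add_sub_cancel]
  refine Finset.card_le_card fun e' he' => ?_
  obtain ⟨heD', hfull'⟩ := Finset.mem_filter.1 he'
  by_contra heF
  -- If `e'` were free for `k`, then `z^{e,e'}` would lie on crossing `k`, hence so would its full
  -- neighbour `z^{e'}`, hence `z`.
  have hmem := (hL.flip_mem_iff hkL hk heD').2 heF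
  rw [flip_flip_comm] at hmem
  refine hL.flip_notMem_crossing hD hfull' hkD heD (fun h => hzk ?_) hmem
  have := (hL.flip_mem_iff hkL h heD').2 heF
  rwa [flip_flip_same] at this

/-- Join full to deficient points by flips in `D`: full points have degree at least `r`, deficient
ones at most `r`, and `r > 0` cancels. -/
theorem IsLightFamily.card_fullPoints_le (hD : ∀ y ∈ cube x D, f y = b)
    (hL : IsLightFamily f b x D L F) (hs : 1 < bSensitivity f (!b)) (hb : 0 < bSensitivity f b) :
    (fullPoints f b x D L).card ≤ (deficientPoints f b x D).card := by
  classical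
  refine Nat.le_of_mul_le_mul_right (Finset.card_mul_le_card_mul
    (m := bSensitivity f (!b) - 1) (n := bSensitivity f (!b) - 1)
    (fun y z => ∃ e ∈ D, z = flip y {e}) ?_ ?_) (by omega)
  · intro y hy
    obtain ⟨i, hi⟩ : (L.filter fun i => y ∈ crossing f b x D i).Nonempty := by
      rw [← Finset.card_pos, (Finset.mem_filter.1 hy).2]
      exact hb
    obtain ⟨hiL, hyi⟩ := Finset.mem_filter.1 hi
    obtain ⟨-, hFD, hF, -⟩ := hL i hiL
    rw [← hF, Nat.add_sub_cancel,
      ← Finset.card_image_of_injective (F i) (flip_singleton_injective y)]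
    refine Finset.card_le_card fun z hz => ?_
    obtain ⟨e, he, rfl⟩ := Finset.mem_image.1 hz
    exact (Finset.mem_bipartiteAbove _).2
      ⟨hL.flip_mem_deficientPoints hD hy hiL hyi he, e, hFD he, rfl⟩
  · intro z hz
    refine le_trans ?_ (hL.card_filter_flip_mem_fullPoints_le hD hz)
    rw [← Finset.card_image_of_injective _ (flip_singleton_injective z)]
    refine Finset.card_le_card fun y hy => ?_
    obtain ⟨hy, e, he, rfl⟩ := (Finset.mem_bipartiteBelow _).1 hy
    refine Finset.mem_image.2 ⟨e, Finset.mem_filter.2 ⟨he, ?_⟩, flip_flip_same y e⟩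
    rwa [flip_flip_same]

theorem sum_card_crossing (S : Finset (Fin n)) :
    ∑ i ∈ S, (crossing f b x D i).card =
      ∑ y ∈ cube x D, (S.filter fun i => y ∈ crossing f b x D i).card := by
  have := Finset.sum_card_bipartiteAbove_eq_sum_card_bipartiteBelow
    (s := S) (t := cube x D) (fun i y => y ∈ crossing f b x D i)
  refine Eq.trans ?_ this
  refine Finset.sum_congr rfl fun i _ => ?_
  congr 1
  ext y
  simp only [Finset.bipartiteAbove, Finset.mem_filter]
  exact ⟨fun h => ⟨crossing_subset i h, h⟩, fun h => h.2⟩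

theorem sum_card_crossing_compl_add_le (hD : ∀ y ∈ cube x D, f y = b) :
    ∑ i ∈ Dᶜ, (crossing f b x D i).card + (deficientPoints f b x D).card ≤
      2 ^ D.card * bSensitivity f b := by
  rw [sum_card_crossing, deficientPoints, Finset.card_filter, ← Finset.sum_add_distrib,
    ← card_cube x D, ← smul_eq_mul]
  refine Finset.sum_le_card_nsmul _ _ _ fun y hy => ?_
  have := card_filter_mem_crossing_le hD hy Dᶜ
  split_ifs <;> omega

/-- Every point that is not full lies on at most `s_b - 1` crossings of `L`. -/
theorem sum_card_crossing_add_le (hD : ∀ y ∈ cube x D, f y = b) (L : Finset (Fin n)) :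
    ∑ i ∈ L, (crossing f b x D i).card + 2 ^ D.card ≤
      2 ^ D.card * bSensitivity f b + (fullPoints f b x D L).card := by
  rw [sum_card_crossing, fullPoints, Finset.card_filter, ← card_cube x D,
    Finset.card_eq_sum_ones (cube x D), Finset.sum_mul, ← Finset.sum_add_distrib,
    ← Finset.sum_add_distrib]
  refine Finset.sum_le_sum fun y hy => ?_
  have := card_filter_mem_crossing_le hD hy L
  split_ifs <;> omega

end Crossing

/-! ### Weighing the crossings, and the final bounds. -/

section Main

variable {f : (Fin n → Bool) → Bool} {b : Bool}

theorem bSensitivity_not_pos_and_pos (hf : ¬ ∃ b : Bool, ∀ x, f x = b)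
    {x : Fin n → Bool} {D : Finset (Fin n)} (hD : ∀ y ∈ cube x D, f y = b)
    (hirr : ∀ i ∉ D, ∃ y ∈ cube x (insert i D), f y ≠ b) :
    0 < bSensitivity f (!b) ∧ 0 < bSensitivity f b := by
  obtain ⟨i, hi⟩ : ∃ i, i ∉ D := by
    by_contra! h
    exact hf ⟨b, fun y => hD y (mem_cube.2 fun i hi => absurd (h i) hi)⟩
  obtain ⟨y, hy⟩ := crossing_nonempty hD (hirr i hi)
  refine ⟨(Nat.zero_le _).trans_lt (card_filter_crossing_lt hD hi hy), ?_⟩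
  refine lt_of_lt_of_le (Finset.card_pos.2 ⟨i, ?_⟩)
    (card_filter_mem_crossing_le hD (crossing_subset i hy) {i})
  exact Finset.mem_filter.2 ⟨Finset.mem_singleton_self i, hy⟩

/-- The crossings of an irreducible certificate split into light ones, which are subcubes of the
least possible size, and heavy ones, which are larger by a factor of at least `3/2`. -/
theorem exists_light_heavy (hs : 0 < bSensitivity f (!b))
    {x : Fin n → Bool} {D : Finset (Fin n)} (hD : ∀ y ∈ cube x D, f y = b)
    (hirr : ∀ i ∉ D, ∃ y ∈ cube x (insert i D), f y ≠ b) :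
    ∃ L ⊆ Dᶜ, (∃ F, IsLightFamily f b x D L F) ∧
      (∀ i ∈ L, 2 ^ (bSensitivity f (!b) - 1) * (crossing f b x D i).card = 2 ^ D.card) ∧
      ∀ i ∈ Dᶜ \ L,
        3 * 2 ^ D.card ≤ 2 * 2 ^ (bSensitivity f (!b) - 1) * (crossing f b x D i).card := by
  classical
  set r := bSensitivity f (!b) - 1 with hr
  let L := Dᶜ.filter fun i => ∃ F ⊆ D, F.card = r ∧ ∃ a, crossing f b x D i = cube a (D \ F)
  have hL : ∀ i ∈ L, ∃ F ⊆ D, F.card = r ∧ ∃ a, crossing f b x D i = cube a (D \ F) :=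
    fun i hi => (Finset.mem_filter.1 hi).2
  refine ⟨L, Finset.filter_subset _ _, ?_, ?_, ?_⟩
  · choose! F hF using hL
    refine ⟨F, fun i hi => ⟨Finset.mem_compl.1 (Finset.mem_filter.1 hi).1, (hF i hi).1, ?_,
      (hF i hi).2.2⟩⟩
    have := (hF i hi).2.1
    omega
  · intro i hi
    obtain ⟨F, hFD, hF, a, ha⟩ := hL i hi
    rw [ha, card_cube, ← pow_add, Finset.card_sdiff_of_subset hFD]
    have := Finset.card_le_card hFD
    congr 1
    omega
  · intro i hi
    obtain ⟨hiD, hiL⟩ := Finset.mem_sdiff.1 hi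
    have hiD' := Finset.mem_compl.1 hiD
    rcases eq_cube_or_three_mul_le D r x _ (crossing_nonempty hD (hirr i hiD'))
      (crossing_subset i)
      (fun y hy => Nat.le_sub_one_of_lt (card_filter_crossing_lt hD hiD' hy)) with h | h
    · exact absurd (Finset.mem_filter.2 ⟨hiD, h⟩) hiL
    · rwa [← pow_succ']

/-- In units of `2^(d-r)` light members weigh 1 and heavy ones at least 3/2, so twice the total plus
the light weight is at least 3 per member. -/
theorem sum_card_crossing_lower {r d : ℕ} {L S : Finset (Fin n)} {c : Fin n → ℕ} (hLS : L ⊆ S)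
    (hlight : ∀ i ∈ L, 2 ^ r * c i = 2 ^ d) (hheavy : ∀ i ∈ S \ L, 3 * 2 ^ d ≤ 2 * 2 ^ r * c i) :
    L.card * 2 ^ d = 2 ^ r * ∑ i ∈ L, c i ∧
      3 * S.card * 2 ^ d ≤ L.card * 2 ^ d + 2 * (2 ^ r * ∑ i ∈ S, c i) := by
  have h1 : L.card * 2 ^ d = 2 ^ r * ∑ i ∈ L, c i := by
    rw [Finset.mul_sum, Finset.sum_congr rfl hlight, Finset.sum_const, smul_eq_mul]
  have h2 : (S \ L).card * (3 * 2 ^ d) ≤ ∑ i ∈ S \ L, 2 * 2 ^ r * c i := by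
    rw [← smul_eq_mul]
    exact Finset.card_nsmul_le_sum _ _ _ hheavy
  rw [← Finset.mul_sum] at h2
  have h3 := Finset.sum_sdiff (f := c) hLS
  have h4 := Finset.card_sdiff_add_card_eq_card hLS
  refine ⟨h1, ?_⟩
  rw [← h3, ← h4]
  linarith

theorem three_mul_card_compl_le (hf : ¬ ∃ b : Bool, ∀ x, f x = b) (hs : 1 < bSensitivity f (!b))
    {x : Fin n → Bool} {D : Finset (Fin n)} (hD : ∀ y ∈ cube x D, f y = b)
    (hirr : ∀ i ∉ D, ∃ y ∈ cube x (insert i D), f y ≠ b) :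
    3 * Dᶜ.card + 2 ^ (bSensitivity f (!b) - 1) ≤
      2 ^ (bSensitivity f (!b) - 1) * (3 * bSensitivity f b) := by
  obtain ⟨hs', hb⟩ := bSensitivity_not_pos_and_pos hf hD hirr
  obtain ⟨L, hLD, ⟨F, hF⟩, hlight, hheavy⟩ := exists_light_heavy hs' hD hirr
  obtain ⟨h1, h2⟩ := sum_card_crossing_lower hLD hlight hheavy
  have h3 := sum_card_crossing_add_le hD L
  have h4 := sum_card_crossing_compl_add_le hD
  have h5 := hF.card_fullPoints_le hD hs hb
  refine Nat.le_of_mul_le_mul_right (c := 2 ^ D.card) ?_ (by positivity)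
  -- This is `h3 + 2 * h4`, with the full points absorbed by the deficient ones.
  have h6 : ∑ i ∈ L, (crossing f b x D i).card + 2 * ∑ i ∈ Dᶜ, (crossing f b x D i).card +
      2 ^ D.card ≤ 3 * (2 ^ D.card * bSensitivity f b) := by omega
  have h7 := Nat.mul_le_mul_left (2 ^ (bSensitivity f (!b) - 1)) h6
  linarith

/-- Here `r = 0`, so every crossing fills the whole subcube. -/
theorem card_compl_le (hs : bSensitivity f (!b) = 1)
    {x : Fin n → Bool} {D : Finset (Fin n)} (hD : ∀ y ∈ cube x D, f y = b)
    (hirr : ∀ i ∉ D, ∃ y ∈ cube x (insert i D), f y ≠ b) :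
    Dᶜ.card ≤ bSensitivity f b := by
  obtain ⟨L, hLD, -, hlight, hheavy⟩ := exists_light_heavy (by omega) hD hirr
  have h4 := sum_card_crossing_compl_add_le hD
  refine Nat.le_of_mul_le_mul_right (c := 2 ^ D.card) ?_ (by positivity)
  have : Dᶜ.card * 2 ^ D.card ≤ ∑ i ∈ Dᶜ, (crossing f b x D i).card := by
    rw [← smul_eq_mul]
    refine Finset.card_nsmul_le_sum _ _ _ fun i hi => ?_
    by_cases hiL : i ∈ L
    · have := hlight i hiL
      simp [hs] at this
      omega
    · have := hheavy i (Finset.mem_sdiff.2 ⟨hi, hiL⟩)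
      simp [hs] at this
      omega
  linarith

theorem bCertificate_eq_bSensitivity (hs : bSensitivity f (!b) = 1) :
    bCertificate f b = bSensitivity f b := by
  refine le_antisymm (Finset.sup_le fun x hx => ?_)
    (Finset.sup_mono_fun fun x _ => sensitivityAt_le_certificateAt f x)
  obtain ⟨D, hle, hD, hirr⟩ := exists_irreducible_certificate f x
  rw [(Finset.mem_filter.1 hx).2] at hD hirr
  exact hle.trans (card_compl_le hs hD hirr)

theorem bCertificate_le (hf : ¬ ∃ b : Bool, ∀ x, f x = b) (hs : 1 < bSensitivity f (!b)) :
    (bCertificate f b : ℝ) ≤ 2 ^ (bSensitivity f (!b) - 1) * ((bSensitivity f b : ℝ) - 1 / 3) := by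
  obtain ⟨x, hx, hmax⟩ := Finset.exists_mem_eq_sup
    (Finset.univ.filter fun x : Fin n → Bool => f x = b) (by
      by_contra h
      refine hf ⟨!b, fun x => ?_⟩
      have : f x ≠ b := fun hx => h ⟨x, Finset.mem_filter.2 ⟨Finset.mem_univ x, hx⟩⟩
      revert this
      cases f x <;> cases b <;> simp) (certificateAt f)
  obtain ⟨D, hle, hD, hirr⟩ := exists_irreducible_certificate f x
  rw [(Finset.mem_filter.1 hx).2] at hD hirr
  have h := three_mul_card_compl_le hf hs hD hirr
  rw [← hmax] at hle
  have h' : 3 * bCertificate f b + 2 ^ (bSensitivity f (!b) - 1) ≤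
      2 ^ (bSensitivity f (!b) - 1) * (3 * bSensitivity f b) := by
    refine le_trans ?_ h
    have : bCertificate f b ≤ Dᶜ.card := hle
    omega
  have h'' : (3 * bCertificate f b + 2 ^ (bSensitivity f (!b) - 1) : ℝ) ≤
      2 ^ (bSensitivity f (!b) - 1) * (3 * bSensitivity f b) := by exact_mod_cast h'
  linarith

end Main

end BooleanComplexity

theorem theorem1 (n : ℕ) (f : (Fin n → Bool) → Bool)
    (hf : ¬ ∃ b : Bool, ∀ x : Fin n → Bool, f x = b) :
    (BooleanComplexity.bSensitivity f true = 1 →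
      BooleanComplexity.bCertificate f false = BooleanComplexity.bSensitivity f false) ∧
    (1 < BooleanComplexity.bSensitivity f true →
      (BooleanComplexity.bCertificate f false : ℝ) ≤
        2 ^ (BooleanComplexity.bSensitivity f true - 1) *
          ((BooleanComplexity.bSensitivity f false : ℝ) - 1 / 3)) ∧
    (BooleanComplexity.bSensitivity f false = 1 →
      BooleanComplexity.bCertificate f true = BooleanComplexity.bSensitivity f true) ∧
    (1 < BooleanComplexity.bSensitivity f false →
      (BooleanComplexity.bCertificate f true : ℝ) ≤
        2 ^ (BooleanComplexity.bSensitivity f false - 1) *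
          ((BooleanComplexity.bSensitivity f true : ℝ) - 1 / 3)) := by
  exact ⟨BooleanComplexity.bCertificate_eq_bSensitivity (b := false),
    BooleanComplexity.bCertificate_le (b := false) hf,
    BooleanComplexity.bCertificate_eq_bSensitivity (b := true),
    BooleanComplexity.bCertificate_le (b := true) hf⟩
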